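/- Let $R$ be an associative ring with identity, not necessarily commutative, and let $\alpha:R\to R$ be a (unital) ring endomorphism. For a ring $S$ with group of units $U(S)$ and Jacobson radical $J(S)$, put $\Delta(S)=\{s\in S : s+u\in U(S)\text{ for all }u\in U(S)\}$. The ring $R$ is called 2-primal if its prime radical (the intersection of all its prime ideals) is exactly the set of nilpotent elements of $R$, and $\alpha$-compatible if for all $a,b\in R$ one has $ab=0$ if and only if $a\alpha(b)=0$. Let $R[x;\alpha]$ be the skew polynomial ring, with multiplication determined by $xr=\alpha(r)x$ for $r\in R$, and regard $R$ as the subring of constant polynomials. Suppose that $R$ is $\alpha$-compatible. 1. If $R$ is 2-primal, then $$\Delta(R[x;\alpha])=\Delta(R)+J(R[x;\alpha]).$$ 2. If $R$ is reduced (has no non-zero nilpotent elements), then $$\Delta(R[x;\alpha])=\Delta(R).$$ -/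

import Mathlib

open scoped Pointwise

/-- `Δ(R) = {r ∈ R | r + U(R) ⊆ U(R)}`. -/
def Delta (R : Type*) [Ring R] : Set R :=
  {r | ∀ u : R, IsUnit u → IsUnit (r + u)}

/-- A prime ideal of a not necessarily commutative ring: a proper two-sided ideal `P` such that
`a R b ⊆ P` implies `a ∈ P` or `b ∈ P`. -/
def IsPrimeTwoSided {R : Type*} [Ring R] (P : TwoSidedIdeal R) : Prop :=
  P ≠ ⊤ ∧ ∀ a b : R, (∀ r : R, a * r * b ∈ P) → a ∈ P ∨ b ∈ P

/-- The prime radical (lower nilradical) of `R`: the intersection of all prime ideals. -/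
def primeRadical (R : Type*) [Ring R] : Set R :=
  {a | ∀ P : TwoSidedIdeal R, IsPrimeTwoSided P → a ∈ P}

/-- `R` is 2-primal: the prime radical consists precisely of the nilpotent elements of `R`. -/
def IsTwoPrimal (R : Type*) [Ring R] : Prop :=
  primeRadical R = {a : R | IsNilpotent a}

/-- `R` is `α`-compatible: `a b = 0` if and only if `a α(b) = 0`, for all `a, b ∈ R`. -/
def IsCompatible {R : Type*} [Ring R] (α : R →+* R) : Prop :=
  ∀ a b : R, a * b = 0 ↔ a * α b = 0

/-- The action of `(ℕ, +)` on `R` in which `n` acts as the `n`-th iterate of `α`. -/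
@[reducible]
def iterateAction {R : Type*} [Ring R] (α : R →+* R) : MulSemiringAction (Multiplicative ℕ) R :=
  MulSemiringAction.compHom R (powersHom (R →+* R) α)

/-- The skew polynomial ring `R[x; α]`: Mathlib's skew polynomials, with the multiplication
given by `x r = α(r) x`. -/
def SkewPoly {R : Type*} [Ring R] (_α : R →+* R) : Type _ := SkewPolynomial R

noncomputable instance SkewPoly.instRing {R : Type*} [Ring R] (α : R →+* R) :
    Ring (SkewPoly α) :=
  letI := iterateAction α
  inferInstanceAs (Ring (SkewPolynomial R))

/-- The embedding of `R` in `R[x; α]` as the constant skew polynomials. -/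
noncomputable def SkewPoly.C {R : Type*} [Ring R] (α : R →+* R) : R →+* SkewPoly α :=
  letI := iterateAction α
  (SkewPolynomial.CRingHom : R →+* SkewPolynomial R)

/-- The indeterminate `x` of `R[x; α]`. -/
noncomputable def SkewPoly.X {R : Type*} [Ring R] (α : R →+* R) : SkewPoly α :=
  (SkewPolynomial.X : SkewPolynomial R)

/-- The defining commutation rule `x r = α(r) x`. -/
theorem SkewPoly.X_mul_C {R : Type*} [Ring R] (α : R →+* R) (r : R) :
    SkewPoly.X α * SkewPoly.C α r = SkewPoly.C α (α r) * SkewPoly.X α := by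
  letI := iterateAction α
  have key : (SkewPolynomial.X : SkewPolynomial R) * SkewPolynomial.CRingHom r
      = SkewPolynomial.CRingHom (α r) * SkewPolynomial.X := by
    rw [SkewPolynomial.CRingHom_eq_C, SkewPolynomial.CRingHom_eq_C, SkewPolynomial.X,
      SkewPolynomial.monomial_mul_C, SkewPolynomial.C_mul_monomial, Function.iterate_one,
      one_mul, mul_one]
    rfl
  exact key

/-! Let `N` be the prime radical, which is the set of nilpotents. Modulo `N` the ring is reduced and
still `α`-compatible, so an Armendariz argument (`coeff_mul_coeff_mem`) applied to `f * f⁻¹ = 1`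
puts the positive-degree coefficients of a unit `f` in `N`; its constant coefficient is a unit of
`R`. Conversely, `N` is locally nilpotent, and compatibility lets one ignore the twists by `α`, so a
polynomial with coefficients in `N` is nilpotent; such polynomials absorb left multiplication, hence
lie in the Jacobson radical. Thus a unit is a constant unit plus a radical element, and adding a
radical element preserves units. For `f ∈ Δ` the same analysis applies to the unit `f + 1`. If `R`
is reduced, `N = 0` and all units are constants. -/

theorem Set.Finite.set_pow {M : Type*} [Monoid M] {s : Set M} (hs : s.Finite) (n : ℕ) :
    (s ^ n).Finite := by
  induction n with
  | zero => rw [pow_zero]; exact Set.finite_one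
  | succ n ih => rw [pow_succ]; exact ih.mul hs

/-! ### Ideals maximal among those avoiding the powers of a set -/

namespace TwoSidedIdeal

variable {R : Type*} [Ring R]

/-- The union of a nonempty chain of two-sided ideals. -/
def chainUnion (c : Set (TwoSidedIdeal R)) (hc : IsChain (· ≤ ·) c) (hne : c.Nonempty) :
    TwoSidedIdeal R :=
  .mk' {x | ∃ I ∈ c, x ∈ I}
    (let ⟨I, hI⟩ := hne; ⟨I, hI, I.zero_mem⟩)
    (by
      rintro x y ⟨I, hI, hx⟩ ⟨J, hJ, hy⟩
      rcases hc.total hI hJ with h | h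
      · exact ⟨J, hJ, J.add_mem (h hx) hy⟩
      · exact ⟨I, hI, I.add_mem hx (h hy)⟩)
    (fun ⟨I, hI, hx⟩ ↦ ⟨I, hI, I.neg_mem hx⟩)
    (fun ⟨I, hI, hx⟩ ↦ ⟨I, hI, I.mul_mem_left _ _ hx⟩)
    (fun ⟨I, hI, hx⟩ ↦ ⟨I, hI, I.mul_mem_right _ _ hx⟩)

theorem mem_chainUnion {c : Set (TwoSidedIdeal R)} {hc : IsChain (· ≤ ·) c} {hne : c.Nonempty}
    {x : R} : x ∈ chainUnion c hc hne ↔ ∃ I ∈ c, x ∈ I :=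
  mem_mk' ..

theorem exists_subset_of_subset_chainUnion {c : Set (TwoSidedIdeal R)}
    {hc : IsChain (· ≤ ·) c} {hne : c.Nonempty} {s : Set R} (hs : s.Finite)
    (h : s ⊆ chainUnion c hc hne) : ∃ I ∈ c, s ⊆ I := by
  induction s, hs using Set.Finite.induction_on with
  | empty => exact hne.imp fun I hI ↦ ⟨hI, Set.empty_subset _⟩
  | insert _ _ ih =>
    rw [Set.insert_subset_iff] at h
    obtain ⟨I, hI, hsI⟩ := ih h.2
    obtain ⟨J, hJ, hxJ⟩ := mem_chainUnion.1 h.1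
    rcases hc.total hI hJ with hle | hle
    · exact ⟨J, hJ, Set.insert_subset hxJ fun y hy ↦ hle (hsI hy)⟩
    · exact ⟨I, hI, Set.insert_subset (hle hxJ) hsI⟩

/-- The elements `u` with `u R b ⊆ P`. -/
def leftColon (P : TwoSidedIdeal R) (b : R) : TwoSidedIdeal R :=
  .mk' {u | ∀ r, u * r * b ∈ P}
    (fun r ↦ by simp [P.zero_mem])
    (fun hx hy r ↦ by simpa only [add_mul] using P.add_mem (hx r) (hy r))
    (fun hx r ↦ by simpa only [neg_mul] using P.neg_mem (hx r))
    (fun {x y} hy r ↦ by simpa only [mul_assoc] using P.mul_mem_left x _ (hy r))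
    (fun {x y} hx r ↦ by simpa only [mul_assoc] using hx (y * r))

theorem mem_leftColon {P : TwoSidedIdeal R} {b u : R} :
    u ∈ P.leftColon b ↔ ∀ r, u * r * b ∈ P :=
  mem_mk' ..

/-- The elements `v` with `s R v ⊆ P`. -/
def rightColon (P : TwoSidedIdeal R) (s : Set R) : TwoSidedIdeal R :=
  .mk' {v | ∀ w ∈ s, ∀ r, w * r * v ∈ P}
    (fun w _ r ↦ by simp [P.zero_mem])
    (fun hx hy w hw r ↦ by simpa only [mul_add] using P.add_mem (hx w hw r) (hy w hw r))
    (fun hx w hw r ↦ by simpa only [mul_neg] using P.neg_mem (hx w hw r))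
    (fun {x y} hy w hw r ↦ by simpa only [mul_assoc] using hy w hw (r * x))
    (fun {x y} hx w hw r ↦ by simpa only [mul_assoc] using P.mul_mem_right _ y (hx w hw r))

theorem mem_rightColon {P : TwoSidedIdeal R} {s : Set R} {v : R} :
    v ∈ P.rightColon s ↔ ∀ w ∈ s, ∀ r, w * r * v ∈ P :=
  mem_mk' ..

/-- A two-sided ideal maximal among those containing no power of `s` is prime. -/
theorem isPrimeTwoSided_of_maximal {P : TwoSidedIdeal R} {s : Set R}
    (hP : Maximal (fun I : TwoSidedIdeal R ↦ ∀ n, ¬ s ^ n ⊆ (I : Set R)) P) :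
    IsPrimeTwoSided P := by
  refine ⟨fun h ↦ hP.prop 0 (by simp [h]), fun a b hab ↦ ?_⟩
  by_contra! hcon
  have key : ∀ I : TwoSidedIdeal R, P ≤ I → ∀ x ∈ I, x ∉ P → ∃ n, s ^ n ⊆ (I : Set R) := by
    intro I hPI x hxI hxP
    by_contra! h
    exact hxP (hP.le_of_ge h hPI hxI)
  -- Both colon ideals strictly contain `P`, so each contains a power of `s`; this gives `s ^ n * R
  -- * s ^ m ⊆ P`.
  obtain ⟨n, hn⟩ := key (P.leftColon b)
    (fun x hx ↦ mem_leftColon.2 fun r ↦ P.mul_mem_right _ _ (P.mul_mem_right _ _ hx)) a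
    (mem_leftColon.2 hab) hcon.1
  obtain ⟨m, hm⟩ := key (P.rightColon (s ^ n))
    (fun x hx ↦ mem_rightColon.2 fun w _ r ↦ P.mul_mem_left _ _ hx) b
    (mem_rightColon.2 fun w hw r ↦ mem_leftColon.1 (hn hw) r) hcon.2
  refine hP.prop (n + m) ?_
  rw [pow_add]
  rintro _ ⟨w, hw, v, hv, rfl⟩
  simpa using mem_rightColon.1 (hm hv) w hw 1

end TwoSidedIdeal

/-! ### Local nilpotency of the prime radical -/

section PrimeRadical

variable {R : Type*} [Ring R]

/-- The prime radical is locally nilpotent. -/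
theorem exists_pow_subset_zero_of_subset_primeRadical {s : Set R} (hs : s.Finite)
    (h : s ⊆ primeRadical R) : ∃ n, s ^ n ⊆ {0} := by
  by_contra! hcon
  -- Zorn applies because `s ^ n` is finite: if a chain's union contains it, so does a member of the
  -- chain.
  obtain ⟨P, -, hP⟩ := zorn_le_nonempty₀
    {I : TwoSidedIdeal R | ∀ n, ¬ s ^ n ⊆ (I : Set R)}
    (fun c hcS hc I hI ↦ ⟨TwoSidedIdeal.chainUnion c hc ⟨I, hI⟩, fun n hn ↦ by
      obtain ⟨J, hJ, hsJ⟩ := TwoSidedIdeal.exists_subset_of_subset_chainUnion (hs.set_pow n) hn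
      exact hcS hJ n hsJ, fun J hJ x hx ↦ TwoSidedIdeal.mem_chainUnion.2 ⟨J, hJ, hx⟩⟩)
    ⊥ (by simpa using hcon)
  refine hP.prop 1 ?_
  rw [pow_one]
  exact fun x hx ↦ h hx P (TwoSidedIdeal.isPrimeTwoSided_of_maximal hP)

theorem isNilpotent_of_mem_primeRadical {a : R} (ha : a ∈ primeRadical R) : IsNilpotent a := by
  obtain ⟨n, hn⟩ := exists_pow_subset_zero_of_subset_primeRadical (Set.finite_singleton a)
    (Set.singleton_subset_iff.2 ha)
  exact ⟨n, by simpa using hn⟩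

theorem isTwoPrimal_of_isReduced [IsReduced R] : IsTwoPrimal R := by
  refine Set.Subset.antisymm (fun a ↦ isNilpotent_of_mem_primeRadical) fun a ha P _ ↦ ?_
  rw [IsNilpotent.eq_zero ha]
  exact P.zero_mem

variable (R) in
/-- The prime radical as a two-sided ideal. -/
def primeRadicalIdeal : TwoSidedIdeal R := sInf {P | IsPrimeTwoSided P}

theorem mem_primeRadicalIdeal {a : R} : a ∈ primeRadicalIdeal R ↔ a ∈ primeRadical R :=
  TwoSidedIdeal.mem_sInf R

theorem IsTwoPrimal.mem_primeRadicalIdeal_iff (h : IsTwoPrimal R) {a : R} :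
    a ∈ primeRadicalIdeal R ↔ IsNilpotent a := by
  rw [mem_primeRadicalIdeal, h, Set.mem_ofPred_eq]

end PrimeRadical

/-! ### Reducedness modulo the ideal of nilpotents -/

section NilIdeal

variable {R : Type*} [Ring R] {N : TwoSidedIdeal R}

theorem isNilpotent_mul_comm {a b : R} (h : IsNilpotent (a * b)) : IsNilpotent (b * a) := by
  obtain ⟨n, hn⟩ := h
  have key : ∀ k, (b * a) ^ (k + 1) = b * (a * b) ^ k * a := by
    intro k
    induction k with
    | zero => simp
    | succ k ih => rw [pow_succ, ih, pow_succ (a * b)]; simp only [mul_assoc]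
  exact ⟨n + 1, by rw [key, hn, mul_zero, zero_mul]⟩

/-- `N` consists precisely of the nilpotent elements. -/
def IsNilSet (N : TwoSidedIdeal R) : Prop := ∀ a, a ∈ N ↔ IsNilpotent a

namespace IsNilSet

theorem mem_of_mul_self (hN : IsNilSet N) {a : R} (h : a * a ∈ N) : a ∈ N := by
  rw [hN] at h ⊢
  rw [← sq] at h
  exact (IsNilpotent.pow_iff_pos two_ne_zero).1 h

theorem mul_comm_mem (hN : IsNilSet N) {a b : R} (h : a * b ∈ N) : b * a ∈ N := by
  rw [hN] at h ⊢
  exact isNilpotent_mul_comm h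

/-- The square of `a * r * b` has the factor `b * a`, which lies in `N`. -/
theorem mul_mul_mem (hN : IsNilSet N) {a b : R} (h : a * b ∈ N) (r : R) : a * r * b ∈ N := by
  refine hN.mem_of_mul_self ?_
  rw [show a * r * b * (a * r * b) = a * r * (b * a) * (r * b) by simp only [mul_assoc]]
  exact N.mul_mem_right _ _ (N.mul_mem_left _ _ (hN.mul_comm_mem h))

theorem mem_of_mul_mul (hN : IsNilSet N) {a b : R} (h : a * (b * b) ∈ N) : a * b ∈ N := by
  rw [← mul_assoc] at h
  have h1 := N.mul_mem_left a _ (hN.mul_comm_mem h)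
  refine hN.mem_of_mul_self ?_
  rwa [mul_assoc a b (a * b)]

end IsNilSet

end NilIdeal

/-! ### Compatibility modulo the nilpotents -/

namespace IsCompatible

variable {R : Type*} [Ring R] {α : R →+* R} {N : TwoSidedIdeal R}

theorem mul_iterate_eq_zero (hα : IsCompatible α) {a b : R} (n : ℕ) :
    a * α^[n] b = 0 ↔ a * b = 0 := by
  induction n with
  | zero => rfl
  | succ n ih => rw [Function.iterate_succ_apply', ← hα, ih]

/-- The trailing `c` lets the induction absorb one factor `a * b`. Compatibility is then used twice:
to apply `α` to `b * c`, and to remove it from `c`. -/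
theorem pow_mul_eq_zero_iff (hα : IsCompatible α) (a b : R) (n : ℕ) (c : R) :
    (a * b) ^ n * c = 0 ↔ (a * α b) ^ n * c = 0 := by
  induction n generalizing c with
  | zero => simp
  | succ n ih =>
    rw [pow_succ, pow_succ, mul_assoc, mul_assoc _ (a * α b), ih, mul_assoc a b,
      ← mul_assoc _ a, hα, map_mul, mul_assoc _ a, ← mul_assoc a, ← mul_assoc _ (a * α b),
      ← hα, mul_assoc]

theorem isNilpotent_mul_iff (hα : IsCompatible α) {a b : R} :
    IsNilpotent (a * α b) ↔ IsNilpotent (a * b) :=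
  exists_congr fun n ↦ by simpa using (hα.pow_mul_eq_zero_iff a b n 1).symm

theorem mul_iterate_mem_iff (hα : IsCompatible α) (hN : IsNilSet N) {a b : R} (n : ℕ) :
    a * α^[n] b ∈ N ↔ a * b ∈ N := by
  induction n with
  | zero => rfl
  | succ n ih =>
    rw [Function.iterate_succ_apply', hN, hα.isNilpotent_mul_iff, ← hN, ih]

theorem iterate_mem (hα : IsCompatible α) (hN : IsNilSet N) {b : R} (hb : b ∈ N) (n : ℕ) :
    α^[n] b ∈ N := by
  simpa using (hα.mul_iterate_mem_iff hN (a := 1) n).2 (by simpa using hb)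

end IsCompatible

/-! ### Coefficients, units and nilpotents of the skew polynomial ring -/

namespace SkewPoly

variable {R : Type*} [Ring R] {α : R →+* R}

/-- The coefficient of `x ^ n`. -/
noncomputable def coeff (f : SkewPoly α) : ℕ → R := SkewPolynomial.coeff f

theorem ext_coeff {f g : SkewPoly α} (h : ∀ n, f.coeff n = g.coeff n) : f = g :=
  SkewPolynomial.ext h

theorem coeff_add (f g : SkewPoly α) (n : ℕ) : (f + g).coeff n = f.coeff n + g.coeff n :=
  SkewPolynomial.coeff_add _ _ _

theorem coeff_sub (f g : SkewPoly α) (n : ℕ) : (f - g).coeff n = f.coeff n - g.coeff n :=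
  let := iterateAction α
  SkewPolynomial.coeff_sub (R := R) _ _ _

theorem coeff_zero (n : ℕ) : (0 : SkewPoly α).coeff n = 0 := rfl

theorem coeff_C_zero (r : R) : (C α r).coeff 0 = r :=
  SkewPolynomial.coeff_C_zero

theorem coeff_C_ne_zero (r : R) {n : ℕ} (hn : n ≠ 0) : (C α r).coeff n = 0 :=
  SkewPolynomial.coeff_C_ne_zero hn

theorem coeff_one_zero : (1 : SkewPoly α).coeff 0 = 1 := by
  rw [← map_one (C α), coeff_C_zero]

theorem coeff_one_ne_zero {n : ℕ} (hn : n ≠ 0) : (1 : SkewPoly α).coeff n = 0 := by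
  rw [← map_one (C α), coeff_C_ne_zero _ hn]

theorem finite_range_coeff (f : SkewPoly α) : (Set.range f.coeff).Finite := by
  refine ((((SkewPolynomial.support f).finite_toSet).image f.coeff).insert 0).subset ?_
  rintro _ ⟨n, rfl⟩
  by_cases h : f.coeff n = 0
  · exact .inl h
  · exact .inr ⟨n, SkewPolynomial.mem_support_iff.2 h, rfl⟩

theorem exists_coeff_eq_zero (f : SkewPoly α) : ∃ m, ∀ n, m ≤ n → f.coeff n = 0 := by
  obtain ⟨m, hm⟩ := (SkewPolynomial.support f).bddAbove
  refine ⟨m + 1, fun n hn ↦ ?_⟩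
  by_contra h
  have := hm (SkewPolynomial.mem_support_iff.2 h : n ∈ SkewPolynomial.support f)
  omega

theorem coeff_mul (f g : SkewPoly α) (n : ℕ) :
    (f * g).coeff n = ∑ p ∈ Finset.HasAntidiagonal.antidiagonal n, f.coeff p.1 * α^[p.1] (g.coeff p.2) := by
  let := iterateAction α
  have h := SkewMonoidAlgebra.coeff_mul_antidiagonal_of_finset (k := R) (G := Multiplicative ℕ)
    f g (Multiplicative.ofAdd n)
    ((Finset.HasAntidiagonal.antidiagonal n).map
      ((Multiplicative.ofAdd (α := ℕ)).toEmbedding.prodMap Multiplicative.ofAdd.toEmbedding))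
    (by
      rintro ⟨a, b⟩
      obtain ⟨a, rfl⟩ := Multiplicative.ofAdd.surjective a
      obtain ⟨b, rfl⟩ := Multiplicative.ofAdd.surjective b
      simp [← ofAdd_add])
  refine Eq.trans h ?_
  rw [Finset.sum_map]
  refine Finset.sum_congr rfl fun p _ ↦ ?_
  refine congrArg (f.coeff p.1 * ·) ?_
  exact (SkewPolynomial.φ_iterate_apply (R := R) p.1 _).symm

theorem coeff_C_mul (r : R) (f : SkewPoly α) (n : ℕ) : (C α r * f).coeff n = r * f.coeff n := by
  rw [coeff_mul, Finset.sum_eq_single (0, n)]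
  · simp [coeff_C_zero]
  · rintro ⟨i, j⟩ hij hne
    have hi : i ≠ 0 := by
      rintro rfl
      simp_all
    rw [coeff_C_ne_zero _ hi, zero_mul]
  · simp

theorem coeff_mul_zero (f g : SkewPoly α) : (f * g).coeff 0 = f.coeff 0 * g.coeff 0 := by
  simp [coeff_mul]

/-- The coefficients of skew polynomials `f`, `g` satisfy `a_i b_j ∈ N` for all `i + j ≥ 1` if
the coefficients of positive degree of `f g` lie in `N`. -/
theorem coeff_mul_coeff_mem {N : TwoSidedIdeal R} (hα : IsCompatible α) (hN : IsNilSet N)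
    {f g : SkewPoly α} (h : ∀ n, n ≠ 0 → (f * g).coeff n ∈ N) {i j : ℕ} (hij : i + j ≠ 0) :
    f.coeff i * g.coeff j ∈ N := by
  obtain ⟨m, hm⟩ := f.exists_coeff_eq_zero
  obtain ⟨l, hl⟩ := g.exists_coeff_eq_zero
  -- Induction on `d` is downward induction on `i + j`: from total degree `m + l` on, one of the two
  -- coefficients vanishes.
  obtain ⟨d, hd⟩ : ∃ d, m + l ≤ i + j + d := ⟨m + l, by omega⟩
  induction d using Nat.strong_induction_on generalizing i j with
  | _ d ihd =>
  have high : ∀ i' j', i + j < i' + j' → f.coeff i' * g.coeff j' ∈ N := by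
    intro i' j' hlt
    rcases d with _ | d
    · rcases le_or_gt m i' with hi | hi
      · simp [hm i' hi, N.zero_mem]
      · simp [hl j' (by omega), N.zero_mem]
    · exact ihd d (by omega) (by omega) (by omega)
  clear ihd
  obtain ⟨k, hk⟩ : ∃ k, i + j = k := ⟨_, rfl⟩
  rw [hk] at hij high
  clear hd
  induction i using Nat.strong_induction_on generalizing j with
  | _ i ihi =>
  -- Multiply the degree-`k` coefficient on the right by `α^[i] (g.coeff j)`. Terms with `i' < i`
  -- are in `N` by the inner induction; those with `i' > i` because `i' + j > k`. Only the term with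
  -- `g.coeff j` squared remains.
  refine hN.mem_of_mul_mul ((hα.mul_iterate_mem_iff hN i).1 ?_)
  have hsum := N.mul_mem_right _ (α^[i] (g.coeff j)) (h k hij)
  rw [coeff_mul, Finset.sum_mul,
    ← Finset.add_sum_erase _ _ (Finset.HasAntidiagonal.mem_antidiagonal.2 hk : (i, j) ∈ _)] at hsum
  rw [iterate_map_mul, ← mul_assoc]
  refine (add_mem_cancel_right (H := N) ?_).1 hsum
  refine sum_mem fun p hp ↦ ?_
  obtain ⟨i', j'⟩ := p
  simp only [Finset.mem_erase, Finset.HasAntidiagonal.mem_antidiagonal, ne_eq, Prod.mk.injEq] at hp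
  rcases lt_trichotomy i' i with hlt | heq | hgt
  · exact N.mul_mem_right _ _ ((hα.mul_iterate_mem_iff hN i').2 (ihi i' hlt hp.2))
  · omega
  · exact (hα.mul_iterate_mem_iff hN i).2 (hN.mul_mul_mem (high i' j (by omega)) _)

theorem isUnit_coeff_zero {f : SkewPoly α} (hf : IsUnit f) : IsUnit (f.coeff 0) := by
  obtain ⟨u, rfl⟩ := hf
  have h₁ := coeff_mul_zero (u : SkewPoly α) (↑u⁻¹ : SkewPoly α)
  have h₂ := coeff_mul_zero (↑u⁻¹ : SkewPoly α) (u : SkewPoly α)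
  rw [Units.mul_inv, coeff_one_zero] at h₁
  rw [Units.inv_mul, coeff_one_zero] at h₂
  exact ⟨⟨_, _, h₁.symm, h₂.symm⟩, rfl⟩

theorem coeff_mem_of_isUnit {N : TwoSidedIdeal R} (hα : IsCompatible α) (hN : IsNilSet N)
    {f : SkewPoly α} (hf : IsUnit f) {n : ℕ} (hn : n ≠ 0) : f.coeff n ∈ N := by
  obtain ⟨u, rfl⟩ := hf
  have h := coeff_mul_coeff_mem hα hN (f := u) (g := (↑u⁻¹ : SkewPoly α))
    (fun k hk ↦ by rw [Units.mul_inv, coeff_one_ne_zero hk]; exact N.zero_mem)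
    (i := n) (j := 0) (by omega)
  -- The constant coefficient of `u⁻¹` is cancelled by that of `u`.
  have h' := N.mul_mem_right _ ((u : SkewPoly α).coeff 0) h
  rwa [mul_assoc, ← coeff_mul_zero, Units.inv_mul, coeff_one_zero, mul_one] at h'

/-- The left factor `c` is left general so that the induction can absorb one coefficient of `f` at a
time; compatibility discards the twist on the remaining power. -/
theorem C_mul_pow_eq_zero (hα : IsCompatible α) (f : SkewPoly α) (n : ℕ) (c : R)
    (h : ∀ w ∈ (Set.range f.coeff) ^ n, c * w = 0) : C α c * f ^ n = 0 := by
  induction n generalizing c with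
  | zero => simp [show c = 0 by simpa using h]
  | succ n ih =>
    refine ext_coeff fun k ↦ ?_
    rw [coeff_C_mul, pow_succ', coeff_mul, Finset.mul_sum]
    refine Finset.sum_eq_zero fun p _ ↦ ?_
    rw [← mul_assoc, hα.mul_iterate_eq_zero, ← coeff_C_mul, ih, coeff_zero]
    intro w hw
    rw [mul_assoc]
    exact h _ (by rw [pow_succ']; exact Set.mul_mem_mul ⟨_, rfl⟩ hw)

theorem isNilpotent_of_coeff_mem_primeRadical (hα : IsCompatible α) {f : SkewPoly α}
    (h : ∀ n, f.coeff n ∈ primeRadical R) : IsNilpotent f := by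
  obtain ⟨n, hn⟩ := exists_pow_subset_zero_of_subset_primeRadical f.finite_range_coeff
    (Set.range_subset_iff.2 h)
  refine ⟨n, ?_⟩
  simpa using f.C_mul_pow_eq_zero hα n 1 fun w hw ↦ by simpa using hn hw

theorem mem_jacobson_of_coeff_mem_primeRadical (hα : IsCompatible α) (hR : IsTwoPrimal R)
    {f : SkewPoly α} (h : ∀ n, f.coeff n ∈ primeRadical R) :
    f ∈ Ring.jacobson (SkewPoly α) := by
  rw [← Ideal.jacobson_bot, Ideal.mem_jacobson_iff]
  intro g
  have hN : IsNilSet (primeRadicalIdeal R) := fun a ↦ hR.mem_primeRadicalIdeal_iff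
  have hnil : IsNilpotent (g * f) := by
    refine isNilpotent_of_coeff_mem_primeRadical hα fun n ↦ ?_
    rw [← mem_primeRadicalIdeal, coeff_mul]
    exact sum_mem fun p _ ↦ TwoSidedIdeal.mul_mem_left _ _ _
      (hα.iterate_mem hN (mem_primeRadicalIdeal.2 (h _)) _)
  obtain ⟨u, hu⟩ := hnil.isUnit_add_one
  refine ⟨(↑u⁻¹ : SkewPoly α), ?_⟩
  rw [mul_assoc, ← mul_add_one, ← hu, Units.inv_mul, sub_self]
  exact zero_mem _

end SkewPoly

/-! ### Units and the Jacobson radical -/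

section Jacobson

variable {S : Type*} [Ring S]

theorem isUnit_one_add_of_mem_jacobson {x : S} (hx : x ∈ Ring.jacobson S) : IsUnit (1 + x) := by
  have key : ∀ y ∈ Ring.jacobson S, ∃ z, z * (1 + y) = 1 := by
    intro y hy
    rw [← Ideal.jacobson_bot] at hy
    obtain ⟨z, hz⟩ := Ideal.exists_mul_add_sub_mem_of_mem_jacobson y hy
    exact ⟨z, by rw [add_comm]; exact sub_eq_zero.1 hz⟩
  obtain ⟨z, hz⟩ := key x hx
  -- The left inverse `z = 1 - z * x` of `1 + x` has a left inverse itself, so it is two-sided.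
  obtain ⟨w, hw⟩ := key (-(z * x)) (neg_mem (Ideal.mul_mem_left _ z hx))
  have hz' : 1 + -(z * x) = z := by
    rw [← hz]; noncomm_ring
  rw [hz'] at hw
  have hwx : w = 1 + x := left_inv_eq_right_inv hw hz
  exact ⟨⟨1 + x, z, hwx ▸ hw, hz⟩, rfl⟩

theorem IsUnit.add_mem_jacobson {u x : S} (hu : IsUnit u) (hx : x ∈ Ring.jacobson S) :
    IsUnit (u + x) := by
  obtain ⟨u, rfl⟩ := hu
  have h := u.isUnit.mul
    (isUnit_one_add_of_mem_jacobson (Ideal.mul_mem_left _ (↑u⁻¹ : S) hx))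
  rwa [mul_add, mul_one, Units.mul_inv_cancel_left] at h

end Jacobson

/-! ### Computation of `Δ` -/

namespace SkewPoly

variable {R : Type*} [Ring R] {α : R →+* R}

theorem coeff_zero_mem_Delta {f : SkewPoly α} (hf : f ∈ Delta (SkewPoly α)) :
    f.coeff 0 ∈ Delta R := fun u hu ↦ by
  simpa [coeff_add, coeff_C_zero] using isUnit_coeff_zero (hf _ (hu.map (C α)))

theorem coeff_mem_of_mem_Delta {N : TwoSidedIdeal R} (hα : IsCompatible α) (hN : IsNilSet N)
    {f : SkewPoly α} (hf : f ∈ Delta (SkewPoly α)) {n : ℕ} (hn : n ≠ 0) : f.coeff n ∈ N := by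
  simpa [coeff_add, coeff_one_ne_zero hn] using coeff_mem_of_isUnit hα hN (hf 1 isUnit_one) hn

theorem sub_C_mem_jacobson (hα : IsCompatible α) (hR : IsTwoPrimal R) {f : SkewPoly α}
    (hf : ∀ n, n ≠ 0 → f.coeff n ∈ primeRadicalIdeal R) :
    f - C α (f.coeff 0) ∈ Ring.jacobson (SkewPoly α) := by
  refine mem_jacobson_of_coeff_mem_primeRadical hα hR fun n ↦ ?_
  rw [← mem_primeRadicalIdeal, coeff_sub]
  rcases eq_or_ne n 0 with rfl | hn
  · simp [coeff_C_zero]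
  · simpa [coeff_C_ne_zero _ hn] using hf n hn

theorem Delta_eq_of_isTwoPrimal (hα : IsCompatible α) (hR : IsTwoPrimal R) :
    Delta (SkewPoly α) =
      C α '' Delta R + (Ring.jacobson (SkewPoly α) : Set (SkewPoly α)) := by
  have hN : IsNilSet (primeRadicalIdeal R) := fun a ↦ hR.mem_primeRadicalIdeal_iff
  refine Set.Subset.antisymm (fun f hf ↦ ?_) ?_
  · exact ⟨_, ⟨_, coeff_zero_mem_Delta hf, rfl⟩, f - C α (f.coeff 0),
      sub_C_mem_jacobson hα hR fun n hn ↦ coeff_mem_of_mem_Delta hα hN hf hn,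
      add_sub_cancel _ _⟩
  · rintro _ ⟨_, ⟨r, hr, rfl⟩, j, hj, rfl⟩ u hu
    have hu' := sub_C_mem_jacobson hα hR fun n hn ↦ coeff_mem_of_isUnit hα hN hu hn
    -- With `u₀` the constant part of `u`, regroup `r + j + u` as `(r + u₀) + (j + (u - u₀))`: a
    -- unit plus a radical element.
    have h := ((hr _ (isUnit_coeff_zero hu)).map (C α)).add_mem_jacobson (add_mem hj hu')
    rw [map_add] at h
    convert h using 1
    dsimp only
    abel

theorem eq_C_coeff_zero_of_isReduced [IsReduced R] {f : SkewPoly α}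
    (hf : ∀ n, n ≠ 0 → f.coeff n ∈ primeRadicalIdeal R) : f = C α (f.coeff 0) := by
  refine ext_coeff fun n ↦ ?_
  rcases eq_or_ne n 0 with rfl | hn
  · rw [coeff_C_zero]
  · rw [coeff_C_ne_zero _ hn]
    exact (isNilpotent_of_mem_primeRadical (mem_primeRadicalIdeal.1 (hf n hn))).eq_zero

theorem Delta_eq_of_isReduced [IsReduced R] (hα : IsCompatible α) :
    Delta (SkewPoly α) = C α '' Delta R := by
  have hN : IsNilSet (primeRadicalIdeal R) := fun a ↦
    isTwoPrimal_of_isReduced.mem_primeRadicalIdeal_iff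
  refine Set.Subset.antisymm (fun f hf ↦ ?_) ?_
  · exact ⟨_, coeff_zero_mem_Delta hf, (eq_C_coeff_zero_of_isReduced fun n hn ↦
      coeff_mem_of_mem_Delta hα hN hf hn).symm⟩
  · rintro _ ⟨r, hr, rfl⟩ u hu
    rw [eq_C_coeff_zero_of_isReduced fun n hn ↦ coeff_mem_of_isUnit hα hN hu hn, ← map_add]
    exact (hr _ (isUnit_coeff_zero hu)).map (C α)

end SkewPoly

theorem proposition2p10 {R : Type*} [Ring R] (α : R →+* R) (hα : IsCompatible α) :
    (IsTwoPrimal R →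
      Delta (SkewPoly α) = SkewPoly.C α '' Delta R + (Ring.jacobson (SkewPoly α) : Set (SkewPoly α))) ∧
    (IsReduced R → Delta (SkewPoly α) = SkewPoly.C α '' Delta R) :=
  ⟨SkewPoly.Delta_eq_of_isTwoPrimal hα, fun _ ↦ SkewPoly.Delta_eq_of_isReduced hα⟩
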